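/- Let $W$ be a Coxeter group with generating set $S$, identity $e$, length function $\ell$ and Bruhat order $\le$. Let $J\subseteq S$, let $W_J$ be the subgroup generated by $J$, and let $W^J$ be the set of minimal length representatives of the cosets $xW_J$. For $a\le b$ in $W$ write $[a,b]=\{y\in W: a\le y\le b\}$. Let $w\in W$ and let $w=vu$ be its parabolic decomposition with respect to $J$, i.e. $v\in W^J$, $u\in W_J$ and $\ell(w)=\ell(v)+\ell(u)$. For $x\in W^J$ with $x\le w$, the set $[e,w]\cap xW_J$ has a unique maximal element $q$ in Bruhat order; put $m_J(w,x):=x^{-1}q$. Then: 1. For every $x\in W^J$ with $x\le w$, the map $y\mapsto x^{-1}y$ is an isomorphism of graded posets $[e,w]\cap xW_J\to[e,m_J(w,x)]$, where both sides carry the Bruhat order, the first is graded by $y\mapsto \ell(y)-\ell(x)$ and the second by $\ell$. 2. $m_J(w,v)=u$. 3. If $x,\bar x\in W^J$ and $x<\bar x\le v$, then $m_J(w,x)\ge m_J(w,\bar x)$. 4. If $x\in W^J$ and $x\le v$, then $m_J(w,x)\in[m_J(w,v),m_J(w,e)]$. -/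

import Mathlib

namespace CoxeterSystem

section

variable {B W : Type*} [Group W] {M : CoxeterMatrix B} (cs : CoxeterSystem M W)

/-- One step up in Bruhat order: `v = u * t` for a reflection `t` (any conjugate of a simple
reflection), and `v` is longer than `u`. -/
def BruhatStep (u v : W) : Prop :=
  ∃ t : W, cs.IsReflection t ∧ v = u * t ∧ cs.length u < cs.length v

/-- Bruhat order: the reflexive transitive closure of the steps. -/
def BruhatLE (u v : W) : Prop :=
  Relation.ReflTransGen cs.BruhatStep u v

theorem BruhatLE.eq_or_length_lt {cs : CoxeterSystem M W} {u v : W} (h : cs.BruhatLE u v) :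
    u = v ∨ cs.length u < cs.length v := by
  induction h with
  | refl => exact Or.inl rfl
  | tail _ hstep ih =>
    obtain ⟨t, _, _, hlt⟩ := hstep
    rcases ih with rfl | ih
    · exact Or.inr hlt
    · exact Or.inr (ih.trans hlt)

/-- Bruhat order as a partial order on `W`. -/
abbrev bruhatOrder : PartialOrder W where
  le := cs.BruhatLE
  le_refl _ := Relation.ReflTransGen.refl
  le_trans _ _ _ h₁ h₂ := Relation.ReflTransGen.trans h₁ h₂
  le_antisymm u v h₁ h₂ := by
    rcases BruhatLE.eq_or_length_lt h₁ with h | h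
    · exact h
    · rcases BruhatLE.eq_or_length_lt h₂ with h' | h'
      · exact h'.symm
      · exact absurd (h.trans h') (lt_irrefl _)

/-- The parabolic subgroup `W_J`, generated by the simple reflections indexed by `J`. -/
def parabolic (J : Set B) : Subgroup W :=
  Subgroup.closure (cs.simple '' J)

/-- The set `W^J` of minimal length representatives of the cosets `x W_J`. -/
def minCosetReps (J : Set B) : Set W :=
  {x | ∀ u ∈ cs.parabolic J, cs.length x ≤ cs.length (x * u)}

/-- The set `[e, w] ∩ x W_J`. -/
def intervalCoset (J : Set B) (w x : W) : Set W :=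
  letI := cs.bruhatOrder
  Set.Iic w ∩ {y | ∃ u ∈ cs.parabolic J, y = x * u}

/-- The element `m_J(w, x) = x⁻¹ q`, where `q` is the maximal element of `[e, w] ∩ x W_J`
in Bruhat order. -/
noncomputable def mJ (J : Set B) (w x : W) : W :=
  letI := cs.bruhatOrder
  x⁻¹ * Classical.epsilon (fun q : W => Maximal (· ∈ cs.intervalCoset J w x) q)

/-- `w = v u` is the parabolic decomposition of `w` with respect to `J`. -/
structure IsParabolicDecomposition (J : Set B) (w v u : W) : Prop where
  eq_mul : w = v * u
  length_eq : cs.length w = cs.length v + cs.length u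
  left_mem : v ∈ cs.minCosetReps J
  right_mem : u ∈ cs.parabolic J

end

end CoxeterSystem

/-!
For a minimal coset representative `x`, everything follows from one fact
(`exists_mul_bruhatLE_iff`): there is `m ∈ W_J` such that, for `a ∈ W_J`, `x a ≤ w` if and only if
`a ≤ m`. Since left multiplication by `x` embeds `W_J` into Bruhat order and adds `ℓ x` to lengths
(`mul_bruhatLE_mul_iff`, `length_mul_of_mem_minCosetReps`), `x m` is then the maximum of
`[e, w] ∩ x W_J`, and this set is the translate `x [e, m]`.

The element `m` is found by induction on `ℓ w`. Let `s` be a left descent of `w`. By Deodhar's lemma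
either `s` moves the whole coset `x W_J` up or down, and the lifting property lets one replace `w` by
`s w` (and `x` by `s x` if it moves down), or `s x = x r` with `r` a simple reflection of `W_J`, and
then `m` is the longer of `m'` and `r m'`, where `m'` belongs to `s w` and `x`.

For `w = v u`, taking `x = v` shows `m_J(w, v) = u`. If `x ≤ x' ≤ w` and `m' = m_J(w, x')`, then
`x m' ≤ x' m' ≤ w` because `x'` is a minimal representative, so `m' ≤ m_J(w, x)`; this gives the
last two claims. The grading comes from the fact that Bruhat covers have length difference one
(`BruhatLE.exists_length_add_one`).

The properties of Bruhat order rest on the strong exchange property, which is obtained from the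
classical action of `W` on signed reflections. Its cocycle `eta` detects right inversions
(`eta_eq_zero_iff`), and the cocycle rule `eta_mul` shows that multiplication by a simple reflection
preserves all Bruhat steps but one, which is the lifting property.
-/

namespace CoxeterSystem

variable {B W : Type*} [Group W] {M : CoxeterMatrix B} (cs : CoxeterSystem M W)

/-! ### The reflection cocycle and strong exchange -/

open Classical in
/-- The action of the simple reflection `s i` on pairs of a group element and a sign: it conjugates
the group element and flips the sign exactly at `s i`. The pairs are indexed by all of `W`, not
only by reflections, which does no harm and avoids subtypes. -/
noncomputable def signedConj (i : B) : Function.End (W × ZMod 2) := fun p ↦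
  (cs.simple i * p.1 * cs.simple i, p.2 + if p.1 = cs.simple i then 1 else 0)

open Classical in
theorem signedConj_mul_pow_apply (i j : B) (k : ℕ) (p : W × ZMod 2) :
    ((cs.signedConj i * cs.signedConj j) ^ k : Function.End (W × ZMod 2)) p =
      ((cs.simple i * cs.simple j) ^ k * p.1 * ((cs.simple i * cs.simple j) ^ k)⁻¹,
        p.2 + ∑ n ∈ Finset.range (2 * k),
          if p.1 = cs.simple j * (cs.simple i * cs.simple j) ^ n then 1 else 0) := by
  set a := cs.simple i with ha
  set b := cs.simple j with hb
  have hbb : b * b = 1 := cs.simple_mul_simple_self j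
  have hai : a⁻¹ = a := cs.inv_simple i
  have hbi : b⁻¹ = b := cs.inv_simple j
  have hconj : ∀ n : ℕ, b * (a * b) ^ n = ((a * b) ^ n)⁻¹ * b := by
    intro n
    rw [← inv_pow, mul_inv_rev, hai, hbi]
    induction n with
    | zero => simp
    | succ n ih =>
      rw [pow_succ, ← mul_assoc, ih, pow_succ]
      simp only [mul_assoc]
  induction k with
  | zero => simp [Function.End.one_def]
  | succ k ih =>
    rw [pow_succ']
    change cs.signedConj i (cs.signedConj j
      (((cs.signedConj i * cs.signedConj j) ^ k : Function.End (W × ZMod 2)) p)) = _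
    rw [ih]
    set c := (a * b) ^ k with hc
    have h1 : (c * p.1 * c⁻¹ = b) ↔ p.1 = b * (a * b) ^ (2 * k) := by
      rw [two_mul, pow_add, ← mul_assoc, hconj, ← hc, mul_inv_eq_iff_eq_mul,
        ← eq_inv_mul_iff_mul_eq, mul_assoc]
    have h2 : (b * (c * p.1 * c⁻¹) * b = a) ↔ p.1 = b * (a * b) ^ (2 * k + 1) := by
      have : b * (a * b) ^ (2 * k + 1) = c⁻¹ * (b * a * b) * c := by
        rw [show 2 * k + 1 = k + (1 + k) by ring, pow_add, pow_add, pow_one, ← mul_assoc, hconj]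
        simp only [mul_assoc, hc]
      rw [this]
      constructor
      · intro h
        rw [← h]
        have : b * (b * (c * p.1 * c⁻¹) * b) * b = (b * b) * (c * p.1 * c⁻¹) * (b * b) := by
          simp only [mul_assoc]
        rw [this, hbb]; group
      · intro h
        rw [h]
        have : b * (c * (c⁻¹ * (b * a * b) * c) * c⁻¹) * b = (b * b) * a * (b * b) := by group
        rw [this, hbb]; simp
    rw [show 2 * (k + 1) = 2 * k + 1 + 1 by ring, Finset.sum_range_succ, Finset.sum_range_succ]
    simp only [signedConj, ← ha, ← hb, h1, h2, add_assoc, Prod.mk.injEq, and_true]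
    rw [pow_succ', ← hc]
    simp only [mul_inv_rev, hai, hbi, mul_assoc]

theorem isLiftable_signedConj : M.IsLiftable cs.signedConj := by
  classical
  intro i j
  funext p
  rw [signedConj_mul_pow_apply, two_mul, Finset.sum_range_add]
  simp only [pow_add, cs.simple_mul_simple_pow, one_mul]
  rw [CharTwo.add_self_eq_zero]
  simp [Function.End.one_def]

/-- The reflection cocycle: `cs.eta w t` is the sign picked up by `t` under the action of `w` on
signed group elements. For a reflection `t` it is nonzero exactly if `t` is a right inversion
of `w`. -/
noncomputable def eta (w t : W) : ZMod 2 :=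
  (cs.lift ⟨cs.signedConj, cs.isLiftable_signedConj⟩ w (t, 0)).2

theorem lift_signedConj_apply (w : W) (p : W × ZMod 2) :
    cs.lift ⟨cs.signedConj, cs.isLiftable_signedConj⟩ w p =
      (w * p.1 * w⁻¹, p.2 + cs.eta w p.1) := by
  induction w using cs.simple_induction_left generalizing p with
  | one => simp [eta, Function.End.one_def]
  | mul_simple_left w i ih =>
    have h : ∀ q, cs.lift ⟨cs.signedConj, cs.isLiftable_signedConj⟩ (cs.simple i * w) q =
        cs.signedConj i (w * q.1 * w⁻¹, q.2 + cs.eta w q.1) := by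
      intro q
      rw [map_mul, lift_apply_simple, ← ih]
      rfl
    rw [eta, h, h]
    simp [signedConj, mul_assoc, add_assoc]

theorem eta_mul (w w' t : W) :
    cs.eta (w * w') t = cs.eta w' t + cs.eta w (w' * t * w'⁻¹) := by
  have h : cs.lift ⟨cs.signedConj, cs.isLiftable_signedConj⟩ (w * w') (t, 0) =
      cs.lift ⟨cs.signedConj, cs.isLiftable_signedConj⟩ w
        (cs.lift ⟨cs.signedConj, cs.isLiftable_signedConj⟩ w' (t, 0)) := by
    rw [map_mul]; rfl
  simpa [lift_signedConj_apply] using congrArg Prod.snd h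

@[simp] theorem eta_one (t : W) : cs.eta 1 t = 0 := by simp [eta, Function.End.one_def]

open Classical in
theorem eta_simple (i : B) (t : W) :
    cs.eta (cs.simple i) t = if t = cs.simple i then 1 else 0 := by
  simp [eta, lift_apply_simple, signedConj]

/-- The cocycle rule for `g * g⁻¹ = 1` makes the two contributions of `g` to `t = g (s i) g⁻¹`
cancel, leaving that of `s i`. -/
theorem eta_self {t : W} (ht : cs.IsReflection t) : cs.eta t t = 1 := by
  obtain ⟨g, i, rfl⟩ := ht
  have h := cs.eta_mul g g⁻¹ (g * cs.simple i * g⁻¹)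
  rw [mul_inv_cancel, eta_one] at h
  rw [eta_mul, eta_mul]
  simp only [eta_simple, mul_assoc, inv_inv, inv_mul_cancel, inv_mul_cancel_left, mul_one, one_mul,
    simple_mul_simple_self, inv_simple, if_true] at h ⊢
  linear_combination -h

theorem mem_rightInvSeq_of_eta_ne_zero {ω : List B} {t : W} (h : cs.eta (cs.wordProd ω) t ≠ 0) :
    t ∈ cs.rightInvSeq ω := by
  induction ω with
  | nil => simp at h
  | cons i ω ih =>
    rw [rightInvSeq, List.mem_cons]
    by_contra! hc
    rw [wordProd_cons, eta_mul, eta_simple, if_neg, add_zero] at h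
    · exact hc.2 (ih h)
    · rintro h'
      apply hc.1
      rw [← h']; group

theorem length_mul_lt_of_eta_ne_zero {w t : W} (h : cs.eta w t ≠ 0) :
    cs.length (w * t) < cs.length w := by
  obtain ⟨ω, hω, rfl⟩ := cs.exists_isReduced w
  exact (cs.isRightInversion_of_mem_rightInvSeq hω (cs.mem_rightInvSeq_of_eta_ne_zero h)).2

theorem eta_eq_zero_iff {w t : W} (ht : cs.IsReflection t) :
    cs.eta w t = 0 ↔ cs.length w < cs.length (w * t) := by
  constructor
  · intro h
    have h1 : cs.eta (w * t) t ≠ 0 := by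
      rw [eta_mul, cs.eta_self ht]
      simp [h]
    have := cs.length_mul_lt_of_eta_ne_zero h1
    rwa [mul_assoc, ht.mul_self, mul_one] at this
  · intro h
    by_contra h'
    exact absurd (cs.length_mul_lt_of_eta_ne_zero h') (by omega)

/-- The strong exchange property: a right inversion occurs in the right inversion sequence of every
word, so multiplying by it deletes a letter. -/
theorem IsRightInversion.exists_eraseIdx {cs : CoxeterSystem M W} {ω : List B} {t : W}
    (h : cs.IsRightInversion (cs.wordProd ω) t) :
    ∃ k < ω.length, cs.wordProd ω * t = cs.wordProd (ω.eraseIdx k) := by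
  have h1 : cs.eta (cs.wordProd ω) t ≠ 0 := fun h0 ↦
    absurd ((cs.eta_eq_zero_iff h.1).1 h0) (by have := h.2; omega)
  obtain ⟨k, hk, rfl⟩ := List.mem_iff_getElem.1 (cs.mem_rightInvSeq_of_eta_ne_zero h1)
  refine ⟨k, by simpa using hk, ?_⟩
  rw [← cs.wordProd_mul_getD_rightInvSeq, List.getD_eq_getElem _ _ hk]

variable {cs}

/-! ### The lifting property of Bruhat order -/

theorem BruhatLE.refl (w : W) : cs.BruhatLE w w := Relation.ReflTransGen.refl

theorem BruhatLE.trans {u v w : W} (h : cs.BruhatLE u v) (h' : cs.BruhatLE v w) :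
    cs.BruhatLE u w := Relation.ReflTransGen.trans h h'

theorem BruhatLE.antisymm {u v : W} (h : cs.BruhatLE u v) (h' : cs.BruhatLE v u) : u = v :=
  cs.bruhatOrder.le_antisymm u v h h'

theorem BruhatStep.bruhatLE {u v : W} (h : cs.BruhatStep u v) : cs.BruhatLE u v :=
  Relation.ReflTransGen.single h

theorem bruhatStep_simple_mul {w : W} {i : B}
    (h : cs.length w < cs.length (cs.simple i * w)) : cs.BruhatStep w (cs.simple i * w) :=
  ⟨w⁻¹ * cs.simple i * w, by simpa using (cs.isReflection_simple i).conj w⁻¹, by group, h⟩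

theorem bruhatStep_mul_simple {w : W} {i : B}
    (h : cs.length w < cs.length (w * cs.simple i)) : cs.BruhatStep w (w * cs.simple i) :=
  ⟨_, cs.isReflection_simple i, rfl, h⟩

theorem bruhatLE_of_simple_mul_lt {w : W} {i : B}
    (h : cs.length (cs.simple i * w) < cs.length w) : cs.BruhatLE (cs.simple i * w) w := by
  have := bruhatStep_simple_mul (cs := cs) (w := cs.simple i * w) (i := i)
    (by rwa [simple_mul_simple_cancel_left])
  rw [simple_mul_simple_cancel_left] at this
  exact this.bruhatLE

/-- Left multiplication by `s i` preserves every Bruhat step except the one along `s i` itself: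
the cocycle value at the reflection of the step changes only there. -/
theorem BruhatStep.simple_mul {u v : W} (h : cs.BruhatStep u v) (i : B) :
    v = cs.simple i * u ∨ cs.BruhatStep (cs.simple i * u) (cs.simple i * v) := by
  obtain ⟨t, ht, rfl, hlt⟩ := h
  by_cases hi : u * t * u⁻¹ = cs.simple i
  · exact Or.inl (by rw [← hi]; group)
  · refine Or.inr ⟨t, ht, by rw [mul_assoc], ?_⟩
    rw [← mul_assoc, ← cs.eta_eq_zero_iff ht, eta_mul, (cs.eta_eq_zero_iff ht).2 hlt, eta_simple,
      if_neg hi, add_zero]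

theorem BruhatStep.mul_simple {u v : W} (h : cs.BruhatStep u v) (i : B) :
    v = u * cs.simple i ∨ cs.BruhatStep (u * cs.simple i) (v * cs.simple i) := by
  obtain ⟨t, ht, rfl, hlt⟩ := h
  by_cases hi : t = cs.simple i
  · exact Or.inl (by rw [hi])
  · have hc : cs.IsReflection (cs.simple i * t * cs.simple i) := by
      simpa using ht.conj (cs.simple i)
    have he : u * t * cs.simple i = u * cs.simple i * (cs.simple i * t * cs.simple i) := by
      simp [mul_assoc]
    refine Or.inr ⟨_, hc, he, ?_⟩
    rw [he, ← cs.eta_eq_zero_iff hc, eta_mul, eta_simple, if_neg]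
    · simpa [mul_assoc] using (cs.eta_eq_zero_iff ht).2 hlt
    · intro h
      apply hi
      calc t = cs.simple i * (cs.simple i * t * cs.simple i) * cs.simple i := by simp [mul_assoc]
        _ = cs.simple i := by rw [h]; simp

/-- The lifting property of Bruhat order, with no assumption on descents; the next lemma is the
variant that lowers `w`. -/
theorem BruhatLE.simple_mul_le_or {u w : W} (h : cs.BruhatLE u w) (i : B) :
    cs.BruhatLE (cs.simple i * u) w ∨ cs.BruhatLE (cs.simple i * u) (cs.simple i * w) := by
  induction h with
  | refl => exact Or.inr (.refl _)
  | tail _ hs ih =>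
    rcases ih with ih | ih
    · exact Or.inl (ih.trans hs.bruhatLE)
    · rcases hs.simple_mul i with rfl | hs'
      · exact Or.inl ih
      · exact Or.inr (ih.trans hs'.bruhatLE)

theorem BruhatLE.le_simple_mul_or {u w : W} (h : cs.BruhatLE u w) (i : B) :
    cs.BruhatLE u (cs.simple i * w) ∨ cs.BruhatLE (cs.simple i * u) (cs.simple i * w) := by
  induction h with
  | refl => exact Or.inr (.refl _)
  | tail h hs ih =>
    rcases hs.simple_mul i with rfl | hs'
    · exact Or.inl (by rwa [simple_mul_simple_cancel_left])
    · exact ih.imp (·.trans hs'.bruhatLE) (·.trans hs'.bruhatLE)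

theorem BruhatLE.mul_simple_le_or {u w : W} (h : cs.BruhatLE u w) (i : B) :
    cs.BruhatLE (u * cs.simple i) w ∨ cs.BruhatLE (u * cs.simple i) (w * cs.simple i) := by
  induction h with
  | refl => exact Or.inr (.refl _)
  | tail _ hs ih =>
    rcases ih with ih | ih
    · exact Or.inl (ih.trans hs.bruhatLE)
    · rcases hs.mul_simple i with rfl | hs'
      · exact Or.inl ih
      · exact Or.inr (ih.trans hs'.bruhatLE)

theorem BruhatLE.simple_mul_le {u w : W} {i : B} (h : cs.BruhatLE u w)
    (hw : cs.length (cs.simple i * w) < cs.length w) : cs.BruhatLE (cs.simple i * u) w :=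
  (h.simple_mul_le_or i).elim id (·.trans (bruhatLE_of_simple_mul_lt hw))

theorem BruhatLE.le_simple_mul {u w : W} {i : B} (h : cs.BruhatLE u w)
    (hu : cs.length u < cs.length (cs.simple i * u)) : cs.BruhatLE u (cs.simple i * w) :=
  (h.le_simple_mul_or i).elim id (bruhatStep_simple_mul hu).bruhatLE.trans

theorem BruhatLE.simple_mul_le_simple_mul {u w : W} {i : B} (h : cs.BruhatLE u w)
    (hu : cs.length (cs.simple i * u) < cs.length u) :
    cs.BruhatLE (cs.simple i * u) (cs.simple i * w) :=
  (h.le_simple_mul_or i).elim (bruhatLE_of_simple_mul_lt hu).trans id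

theorem BruhatLE.of_simple_mul {u w : W} {i : B}
    (h : cs.BruhatLE (cs.simple i * u) (cs.simple i * w))
    (hw : cs.length (cs.simple i * w) < cs.length w) : cs.BruhatLE u w := by
  simpa using (h.trans (bruhatLE_of_simple_mul_lt hw)).simple_mul_le hw

theorem BruhatLE.mul_simple_le_mul_simple {u w : W} {i : B} (h : cs.BruhatLE u w)
    (hw : cs.length w < cs.length (w * cs.simple i)) :
    cs.BruhatLE (u * cs.simple i) (w * cs.simple i) :=
  (h.mul_simple_le_or i).elim (·.trans (bruhatStep_mul_simple hw).bruhatLE) id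

/-- Bruhat order is graded: below `w` and above any `u < w` there is an element one shorter
than `w`. -/
theorem BruhatLE.exists_length_add_one {u w : W} (h : cs.BruhatLE u w) (hne : u ≠ w) :
    ∃ z, cs.BruhatLE u z ∧ cs.BruhatLE z w ∧ cs.length w = cs.length z + 1 := by
  induction hn : cs.length w generalizing u w with
  | zero =>
    rcases h.eq_or_length_lt with h | h
    · exact absurd h hne
    · omega
  | succ n ih =>
    have hw1 : w ≠ 1 := by rintro rfl; simp at hn
    obtain ⟨i, hi⟩ := cs.exists_leftDescent_of_ne_one hw1
    have hl := cs.isLeftDescent_iff.1 hi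
    have hsw := bruhatLE_of_simple_mul_lt hi
    rcases cs.length_simple_mul u i with hu | hu
    · exact ⟨cs.simple i * w, h.le_simple_mul (by omega), hsw, by omega⟩
    · obtain ⟨z, hz, hz', hzl⟩ := ih (h.simple_mul_le_simple_mul (i := i) (by omega))
        (by simpa using hne) (by omega)
      rcases cs.length_simple_mul z i with hzi | hzi
      · refine ⟨cs.simple i * z, BruhatLE.of_simple_mul (i := i) ?_ ?_, ?_, by omega⟩
        · rwa [simple_mul_simple_cancel_left]
        · rw [simple_mul_simple_cancel_left]; omega
        · exact (hz'.trans hsw).simple_mul_le hi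
      · refine ⟨cs.simple i * w, ?_, hsw, by omega⟩
        have := hz.simple_mul_le (i := i) (by omega)
        rw [simple_mul_simple_cancel_left] at this
        exact this.trans hz'

theorem one_bruhatLE (w : W) : cs.BruhatLE 1 w := by
  induction hn : cs.length w generalizing w with
  | zero => rw [cs.length_eq_zero_iff.1 hn]; exact .refl _
  | succ n ih =>
    obtain ⟨i, hi⟩ := cs.exists_leftDescent_of_ne_one (w := w) (by rintro rfl; simp at hn)
    have hl := cs.isLeftDescent_iff.1 hi
    exact (ih (cs.simple i * w) (by omega)).trans (bruhatLE_of_simple_mul_lt hi)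

/-! ### Parabolic subgroups and minimal coset representatives -/

theorem simple_mem_parabolic {J : Set B} {i : B} (hi : i ∈ J) : cs.simple i ∈ cs.parabolic J :=
  Subgroup.subset_closure ⟨i, hi, rfl⟩

theorem wordProd_mem_parabolic {J : Set B} {ω : List B} (h : ∀ i ∈ ω, i ∈ J) :
    cs.wordProd ω ∈ cs.parabolic J := by
  induction ω with
  | nil => simp
  | cons i ω ih =>
    rw [wordProd_cons]
    exact mul_mem (simple_mem_parabolic (h i (by simp))) (ih fun j hj ↦ h j (by simp [hj]))

theorem exists_isReduced_of_mem_parabolic {J : Set B} {a : W} (ha : a ∈ cs.parabolic J) :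
    ∃ ω : List B, (∀ i ∈ ω, i ∈ J) ∧ cs.IsReduced ω ∧ cs.wordProd ω = a := by
  have mul : ∀ x : W, ∀ i ∈ J,
      (∃ ω : List B, (∀ i ∈ ω, i ∈ J) ∧ cs.IsReduced ω ∧ cs.wordProd ω = x) →
      ∃ ω : List B, (∀ i ∈ ω, i ∈ J) ∧ cs.IsReduced ω ∧ cs.wordProd ω = x * cs.simple i := by
    rintro _ i hi ⟨ω, hω, hr, rfl⟩
    rcases cs.length_mul_simple (cs.wordProd ω) i with h | h
    · refine ⟨ω.concat i, ?_, ?_, cs.wordProd_concat i ω⟩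
      · simp only [List.concat_eq_append, List.mem_append, List.mem_singleton]
        rintro j (hj | rfl)
        exacts [hω j hj, hi]
      · rw [IsReduced, wordProd_concat, h, hr, List.length_concat]
    · obtain ⟨k, hk, he⟩ := IsRightInversion.exists_eraseIdx
        (cs := cs) (ω := ω) (t := cs.simple i) ⟨cs.isReflection_simple i, by omega⟩
      refine ⟨ω.eraseIdx k, fun j hj ↦ hω j (List.mem_of_mem_eraseIdx hj), ?_, he.symm⟩
      rw [IsReduced, ← he, List.length_eraseIdx_of_lt hk, ← hr]
      omega
  induction ha using Subgroup.closure_induction_right with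
  | one => exact ⟨[], by simp, by simp [IsReduced], by simp⟩
  | mul_right x y _ hy ih =>
    obtain ⟨i, hi, rfl⟩ := hy
    exact mul x i hi ih
  | mul_inv_cancel x y _ hy ih =>
    obtain ⟨i, hi, rfl⟩ := hy
    rw [inv_simple]
    exact mul x i hi ih

/-- Induction over a parabolic subgroup along length-increasing right multiplications. -/
@[elab_as_elim]
theorem parabolic_induction {J : Set B} {p : (a : W) → a ∈ cs.parabolic J → Prop}
    (one : p 1 (one_mem _))
    (mul : ∀ (a) (ha : a ∈ cs.parabolic J) (i) (hi : i ∈ J),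
      cs.length (a * cs.simple i) = cs.length a + 1 → p a ha →
        p (a * cs.simple i) (mul_mem ha (simple_mem_parabolic hi)))
    {a : W} (ha : a ∈ cs.parabolic J) : p a ha := by
  obtain ⟨ω, hω, hr, rfl⟩ := exists_isReduced_of_mem_parabolic ha
  induction ω using List.reverseRecOn with
  | nil => simpa using one
  | append_singleton ω i ih =>
    have hr' : cs.IsReduced ω := by simpa using hr.take ω.length
    have hω' : ∀ j ∈ ω, j ∈ J := fun j hj ↦ hω j (by simp [hj])
    have := mul _ (wordProd_mem_parabolic hω') i (hω i (by simp)) ?_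
      (ih hω' hr' (wordProd_mem_parabolic hω'))
    · simpa only [wordProd_append, wordProd_singleton] using this
    · rw [hr'.eq]
      have := hr.eq
      rwa [wordProd_append, wordProd_singleton, List.length_append] at this

/-- Parabolic subgroups are lower sets in Bruhat order: a step down deletes a letter. -/
theorem BruhatLE.mem_parabolic {J : Set B} {a b : W} (h : cs.BruhatLE b a)
    (ha : a ∈ cs.parabolic J) : b ∈ cs.parabolic J := by
  induction h using Relation.ReflTransGen.head_induction_on with
  | refl => exact ha
  | head hs _ ih =>
    obtain ⟨t, ht, rfl, hlt⟩ := hs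
    obtain ⟨ω, hω, _, he⟩ := exists_isReduced_of_mem_parabolic ih
    obtain ⟨k, _, hk⟩ := IsRightInversion.exists_eraseIdx (cs := cs) (ω := ω) (t := t)
      ⟨ht, by rwa [he, mul_assoc, ht.mul_self, mul_one]⟩
    rw [he, mul_assoc, ht.mul_self, mul_one] at hk
    rw [hk]
    exact wordProd_mem_parabolic fun j hj ↦ hω j (List.mem_of_mem_eraseIdx hj)

/-- A descent of `x * a` in `J` that is not one of `a` would give, by the cocycle rule, a right
inversion of `x` in `W_J`, contradicting minimality of `x`. -/
theorem length_mul_of_mem_minCosetReps {J : Set B} {x a : W} (hx : x ∈ cs.minCosetReps J)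
    (ha : a ∈ cs.parabolic J) : cs.length (x * a) = cs.length x + cs.length a := by
  induction ha using parabolic_induction with
  | one => simp
  | mul a ha i hi hl ih =>
    have hc : cs.eta x (a * cs.simple i * a⁻¹) = 0 := by
      by_contra h
      have h1 := cs.length_mul_lt_of_eta_ne_zero h
      have h2 := hx _ (mul_mem (mul_mem ha (simple_mem_parabolic hi)) (inv_mem ha))
      omega
    have h0 : cs.eta (x * a) (cs.simple i) = 0 := by
      rw [eta_mul, hc, add_zero, cs.eta_eq_zero_iff (cs.isReflection_simple i)]
      omega
    rw [cs.eta_eq_zero_iff (cs.isReflection_simple i)] at h0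
    have := cs.length_mul_simple (x * a) i
    rw [← mul_assoc]
    omega

theorem one_mem_minCosetReps (J : Set B) : (1 : W) ∈ cs.minCosetReps J := fun _ _ ↦ by simp

theorem simple_mul_mem_minCosetReps_of_lt {J : Set B} {x : W} {i : B}
    (hx : x ∈ cs.minCosetReps J) (hi : cs.length (cs.simple i * x) < cs.length x) :
    cs.simple i * x ∈ cs.minCosetReps J := by
  intro a ha
  have h1 := length_mul_of_mem_minCosetReps hx ha
  have h2 := cs.length_simple_mul (x * a) i
  have h3 := cs.length_simple_mul x i
  rw [mul_assoc]
  by_cases h : cs.length a = 0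
  · rw [cs.length_eq_zero_iff.1 h]; simp
  · omega

/-- Minimality in a coset can be tested on simple reflections. -/
theorem mem_minCosetReps_of_forall_simple {J : Set B} {y : W}
    (h : ∀ i ∈ J, cs.length y < cs.length (y * cs.simple i)) : y ∈ cs.minCosetReps J := by
  obtain ⟨a, ha, hmin⟩ := exists_minimalFor_of_wellFoundedLT (· ∈ cs.parabolic J)
    (fun a ↦ cs.length (y * a)) ⟨1, one_mem _⟩
  have hx : y * a ∈ cs.minCosetReps J := by
    intro b hb
    rw [mul_assoc]
    exact (le_total _ _).elim id (hmin (mul_mem ha hb))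
  suffices a⁻¹ = 1 by simpa [inv_eq_one.1 this] using hx
  have key : ∀ b ∈ cs.parabolic J, y * a * b = y → b = 1 := by
    intro b hb
    induction hb using parabolic_induction with
    | one => simp
    | mul b hb i hi hl _ =>
      intro hy
      have h1 := h i hi
      have h2 := length_mul_of_mem_minCosetReps hx hb
      have h3 := length_mul_of_mem_minCosetReps hx (mul_mem hb (simple_mem_parabolic hi))
      rw [hy] at h3
      have hyi : y * cs.simple i = y * a * b := by
        conv_lhs => rw [← hy]
        rw [← mul_assoc, simple_mul_simple_cancel_right]
      rw [hyi] at h1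
      omega
  exact key _ (inv_mem ha) (by group)

/-- Deodhar's lemma: left multiplication by a simple reflection either stays among the minimal
coset representatives or stays in the coset. -/
theorem simple_mul_mem_minCosetReps_or {J : Set B} {x : W} (hx : x ∈ cs.minCosetReps J) (i : B) :
    cs.simple i * x ∈ cs.minCosetReps J ∨ ∃ j ∈ J, cs.simple i * x = x * cs.simple j := by
  by_contra! hc
  refine hc.1 (mem_minCosetReps_of_forall_simple fun j hj ↦ ?_)
  have hr := cs.isReflection_simple j
  rw [← cs.eta_eq_zero_iff hr, eta_mul, eta_simple, if_neg, add_zero, cs.eta_eq_zero_iff hr,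
    length_mul_of_mem_minCosetReps hx (simple_mem_parabolic hj), length_simple]
  · omega
  · intro h
    apply hc.2 j hj
    rw [← h]; group

/-- Left multiplication by `x ∈ W^J` is an embedding of `W_J` into Bruhat order. -/
theorem mul_bruhatLE_mul_iff {J : Set B} {x a b : W} (hx : x ∈ cs.minCosetReps J)
    (ha : a ∈ cs.parabolic J) (hb : b ∈ cs.parabolic J) :
    cs.BruhatLE (x * a) (x * b) ↔ cs.BruhatLE a b := by
  induction hn : cs.length x generalizing x with
  | zero => simp [cs.length_eq_zero_iff.1 hn]
  | succ n ih =>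
    obtain ⟨i, hi⟩ := cs.exists_leftDescent_of_ne_one (w := x) (by rintro rfl; simp at hn)
    have hl := cs.isLeftDescent_iff.1 hi
    have hx' := simple_mul_mem_minCosetReps_of_lt hx hi
    have hd : ∀ {c}, c ∈ cs.parabolic J →
        cs.length (cs.simple i * (x * c)) < cs.length (x * c) := by
      intro c hc
      rw [← mul_assoc, length_mul_of_mem_minCosetReps hx' hc, length_mul_of_mem_minCosetReps hx hc]
      omega
    rw [← ih hx' (by omega), mul_assoc, mul_assoc]
    exact ⟨fun h ↦ h.simple_mul_le_simple_mul (hd ha), fun h ↦ h.of_simple_mul (hd hb)⟩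

theorem BruhatLE.mul_right_of_mem_minCosetReps {J : Set B} {x x' a : W} (h : cs.BruhatLE x x')
    (hx' : x' ∈ cs.minCosetReps J) (ha : a ∈ cs.parabolic J) :
    cs.BruhatLE (x * a) (x' * a) := by
  induction ha using parabolic_induction with
  | one => simpa using h
  | mul a ha i hi hl ih =>
    rw [← mul_assoc, ← mul_assoc]
    refine ih.mul_simple_le_mul_simple ?_
    rw [mul_assoc, length_mul_of_mem_minCosetReps hx' ha,
      length_mul_of_mem_minCosetReps hx' (mul_mem ha (simple_mem_parabolic hi))]
    omega

/-! ### Intersecting a lower interval with a coset -/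

/-- The heart of the matter: `[e, w] ∩ x W_J` is the translate `x [e, m]` of a lower interval.
The element `m` is built along a reduced word of `w`, by a Demazure product inside `W_J`. -/
theorem exists_mul_bruhatLE_iff {J : Set B} {x w : W} (hx : x ∈ cs.minCosetReps J)
    (hxw : cs.BruhatLE x w) :
    ∃ m ∈ cs.parabolic J, ∀ a ∈ cs.parabolic J, cs.BruhatLE (x * a) w ↔ cs.BruhatLE a m := by
  induction hn : cs.length w generalizing x w with
  | zero =>
    rw [cs.length_eq_zero_iff.1 hn] at hxw ⊢
    obtain rfl := hxw.antisymm (one_bruhatLE x)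
    exact ⟨1, one_mem _, fun a _ ↦ by rw [one_mul]⟩
  | succ n ih =>
    obtain ⟨i, hi⟩ := cs.exists_leftDescent_of_ne_one (w := w) (by rintro rfl; simp at hn)
    have hl := cs.isLeftDescent_iff.1 hi
    have hsw := bruhatLE_of_simple_mul_lt hi
    rcases cs.length_simple_mul x i with hxi | hxi
    · obtain ⟨m, hm, hiff⟩ := ih hx (hxw.le_simple_mul (i := i) (by omega)) (by omega)
      rcases simple_mul_mem_minCosetReps_or hx i with hx' | ⟨j, hj, hxj⟩
      -- every element of the coset goes up under `s i`, so the part below `w` is the part below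
      -- `s i * w`
      · refine ⟨m, hm, fun a ha ↦ ?_⟩
        rw [← hiff a ha]
        refine ⟨fun h ↦ h.le_simple_mul ?_, fun h ↦ h.trans hsw⟩
        rw [← mul_assoc, length_mul_of_mem_minCosetReps hx' ha, length_mul_of_mem_minCosetReps hx ha]
        omega
      -- `s i` acts on the coset as left multiplication by `s j` on `W_J`, so `m` becomes the
      -- longer of `m` and `s j * m`
      · have hja : ∀ a, cs.simple i * (x * a) = x * (cs.simple j * a) := fun a ↦ by
          rw [← mul_assoc, hxj, mul_assoc]
        have key : ∃ m' ∈ cs.parabolic J, cs.length (cs.simple j * m') < cs.length m' ∧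
            cs.BruhatLE m m' ∧ (m = m' ∨ m = cs.simple j * m') := by
          rcases cs.length_simple_mul m j with h | h
          · exact ⟨cs.simple j * m, mul_mem (simple_mem_parabolic hj) hm, by simp; omega,
              (bruhatStep_simple_mul (by omega)).bruhatLE, by simp⟩
          · exact ⟨m, hm, by omega, .refl _, Or.inl rfl⟩
        obtain ⟨m', hm', hdesc, hmm', hcase⟩ := key
        have of_le : ∀ a ∈ cs.parabolic J, cs.BruhatLE a m → cs.BruhatLE (x * a) w :=
          fun a ha h ↦ ((hiff a ha).2 h).trans hsw
        have of_le' : ∀ a ∈ cs.parabolic J, cs.BruhatLE (cs.simple j * a) m →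
            cs.BruhatLE (x * a) w := fun a ha h ↦ by
          have := of_le _ (mul_mem (simple_mem_parabolic hj) ha) h
          rw [← hja] at this
          simpa using this.simple_mul_le hi
        refine ⟨m', hm', fun a ha ↦ ⟨fun h ↦ ?_, fun h ↦ ?_⟩⟩
        · rcases h.le_simple_mul_or i with h' | h'
          · exact ((hiff a ha).1 h').trans hmm'
          · rw [hja, hiff _ (mul_mem (simple_mem_parabolic hj) ha)] at h'
            simpa using (h'.trans hmm').simple_mul_le hdesc
        · rcases hcase with rfl | rfl
          · exact of_le a ha h
          · exact (h.le_simple_mul_or j).elim (of_le a ha) (of_le' a ha)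
    -- every element of the coset goes down under `s i`
    · have hx' := simple_mul_mem_minCosetReps_of_lt (i := i) hx (by omega)
      obtain ⟨m, hm, hiff⟩ := ih hx' (hxw.simple_mul_le_simple_mul (i := i) (by omega)) (by omega)
      refine ⟨m, hm, fun a ha ↦ ?_⟩
      rw [← hiff a ha, mul_assoc]
      refine ⟨fun h ↦ h.simple_mul_le_simple_mul ?_, fun h ↦ h.of_simple_mul hi⟩
      rw [← mul_assoc, length_mul_of_mem_minCosetReps hx' ha, length_mul_of_mem_minCosetReps hx ha]
      omega

theorem mul_mem_intervalCoset_iff {J : Set B} {x w a : W} :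
    x * a ∈ cs.intervalCoset J w x ↔ cs.BruhatLE (x * a) w ∧ a ∈ cs.parabolic J := by
  refine and_congr Iff.rfl ⟨?_, fun h ↦ ⟨a, h, rfl⟩⟩
  rintro ⟨b, hb, h⟩
  rwa [mul_left_cancel h]

theorem maximal_intervalCoset_iff {J : Set B} {x w m : W} (hx : x ∈ cs.minCosetReps J)
    (hm : m ∈ cs.parabolic J)
    (hiff : ∀ a ∈ cs.parabolic J, cs.BruhatLE (x * a) w ↔ cs.BruhatLE a m) (q : W) :
    letI : PartialOrder W := cs.bruhatOrder
    Maximal (· ∈ cs.intervalCoset J w x) q ↔ q = x * m := by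
  let _ : PartialOrder W := cs.bruhatOrder
  have hmem : x * m ∈ cs.intervalCoset J w x :=
    mul_mem_intervalCoset_iff.2 ⟨(hiff m hm).2 (.refl m), hm⟩
  have hle : ∀ y ∈ cs.intervalCoset J w x, y ≤ x * m := by
    rintro _ ⟨hy, a, ha, rfl⟩
    exact (mul_bruhatLE_mul_iff hx ha hm).2 ((hiff a ha).1 hy)
  constructor
  · exact fun h ↦ h.eq_of_le hmem (hle q h.prop)
  · rintro rfl
    exact ⟨hmem, fun y hy _ ↦ hle y hy⟩

theorem mJ_eq {J : Set B} {x w m : W} (hx : x ∈ cs.minCosetReps J) (hm : m ∈ cs.parabolic J)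
    (hiff : ∀ a ∈ cs.parabolic J, cs.BruhatLE (x * a) w ↔ cs.BruhatLE a m) :
    cs.mJ J w x = m := by
  have h := maximal_intervalCoset_iff hx hm hiff
  have := (h _).1 (Classical.epsilon_spec ⟨x * m, (h _).2 rfl⟩)
  rw [mJ, this, inv_mul_cancel_left]

theorem mJ_spec {J : Set B} {x w : W} (hx : x ∈ cs.minCosetReps J) (hxw : cs.BruhatLE x w) :
    cs.mJ J w x ∈ cs.parabolic J ∧
      ∀ a ∈ cs.parabolic J, cs.BruhatLE (x * a) w ↔ cs.BruhatLE a (cs.mJ J w x) := by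
  obtain ⟨m, hm, hiff⟩ := exists_mul_bruhatLE_iff hx hxw
  rw [mJ_eq hx hm hiff]
  exact ⟨hm, hiff⟩

theorem mJ_antitone {J : Set B} {x x' w : W} (hx : x ∈ cs.minCosetReps J)
    (hx' : x' ∈ cs.minCosetReps J) (hxx' : cs.BruhatLE x x') (hx'w : cs.BruhatLE x' w) :
    cs.BruhatLE (cs.mJ J w x') (cs.mJ J w x) := by
  obtain ⟨hm, -⟩ := mJ_spec hx (hxx'.trans hx'w)
  obtain ⟨hm', hiff'⟩ := mJ_spec hx' hx'w
  rw [← (mJ_spec hx (hxx'.trans hx'w)).2 _ hm']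
  exact (hxx'.mul_right_of_mem_minCosetReps hx' hm').trans ((hiff' _ hm').2 (.refl _))

theorem mJ_mul_self {J : Set B} {v u : W} (hv : v ∈ cs.minCosetReps J)
    (hu : u ∈ cs.parabolic J) : cs.mJ J (v * u) v = u :=
  mJ_eq hv hu fun _ ha ↦ mul_bruhatLE_mul_iff hv ha hu

theorem bruhatLE_mul_right {J : Set B} {v u : W} (hv : v ∈ cs.minCosetReps J)
    (hu : u ∈ cs.parabolic J) : cs.BruhatLE v (v * u) := by
  simpa using (mul_bruhatLE_mul_iff hv (one_mem _) hu).2 (one_bruhatLE u)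

/-! ### Grading -/

/-- The length function grades every order that embeds into Bruhat order as a lower set. -/
noncomputable abbrev lengthGradeMinOrder {α : Type*} [PartialOrder α] (φ : α → W)
    (hφ : ∀ a b, cs.BruhatLE (φ a) (φ b) ↔ a ≤ b)
    (hlower : ∀ a z, cs.BruhatLE z (φ a) → ∃ b, φ b = z) : GradeMinOrder ℕ α where
  grade a := cs.length (φ a)
  grade_strictMono a b h := by
    refine ((hφ a b).2 h.le).eq_or_length_lt.resolve_left fun he ↦ h.not_ge ?_
    rw [← hφ, he]
    exact .refl _
  covBy_grade a b h := by
    have hne : φ a ≠ φ b := fun he ↦ h.lt.not_ge (by rw [← hφ, he]; exact .refl _)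
    obtain ⟨z, haz, hzb, hl⟩ := ((hφ a b).2 h.le).exists_length_add_one hne
    obtain ⟨c, rfl⟩ := hlower b z hzb
    have hcb : c < b := lt_of_le_of_ne ((hφ _ _).1 hzb) (by rintro rfl; omega)
    obtain rfl : c = a := (h.eq_or_eq ((hφ _ _).1 haz) hcb.le).resolve_right hcb.ne
    rw [Nat.covBy_iff_add_one_eq]
    exact hl.symm
  isMin_grade a h := by
    obtain ⟨b, hb⟩ := hlower a 1 (one_bruhatLE _)
    have : b = a := h.eq_of_le ((hφ _ _).1 (hb ▸ one_bruhatLE _))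
    rw [← this, hb, cs.length_one]
    exact isMin_bot

/-- Left translation by `x⁻¹` as an order isomorphism of `[e, w] ∩ x W_J` with `[e, m_J(w, x)]`. -/
def intervalCosetIso {J : Set B} {x w : W} (hx : x ∈ cs.minCosetReps J)
    (hxw : cs.BruhatLE x w) :
    letI : PartialOrder W := cs.bruhatOrder
    cs.intervalCoset J w x ≃o Set.Iic (cs.mJ J w x) :=
  letI : PartialOrder W := cs.bruhatOrder
  have hmem : ∀ y ∈ cs.intervalCoset J w x, x⁻¹ * y ∈ cs.parabolic J := by
    rintro _ ⟨-, a, ha, rfl⟩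
    rwa [inv_mul_cancel_left]
  { toFun y := ⟨x⁻¹ * y, ((mJ_spec hx hxw).2 _ (hmem y y.2)).1
      (by rw [mul_inv_cancel_left]; exact y.2.1)⟩
    invFun z := ⟨x * z, mul_mem_intervalCoset_iff.2 (by
      have hz := BruhatLE.mem_parabolic z.2 (mJ_spec hx hxw).1
      exact ⟨((mJ_spec hx hxw).2 _ hz).2 z.2, hz⟩)⟩
    left_inv y := by simp
    right_inv z := by simp
    map_rel_iff' {y y'} := by
      have := mul_bruhatLE_mul_iff hx (hmem y y.2) (hmem y' y'.2)
      rw [mul_inv_cancel_left, mul_inv_cancel_left] at this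
      exact this.symm }

end CoxeterSystem

theorem proposition2p2 {B W : Type*} [Group W] {M : CoxeterMatrix B} (cs : CoxeterSystem M W)
    (J : Set B) (w v u : W) (hw : cs.IsParabolicDecomposition J w v u) :
    letI : PartialOrder W := cs.bruhatOrder
    -- `m_J(w, x)` is well defined
    (∀ x ∈ cs.minCosetReps J, x ≤ w → ∃! q : W, Maximal (· ∈ cs.intervalCoset J w x) q) ∧
    -- `y ↦ x⁻¹ y` is an isomorphism of graded posets; Mathlib's `GradeMinOrder ℕ` says that
    -- the rank is strictly monotone, increases by one along covers, and is 0 at minimal elements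
    (∀ x ∈ cs.minCosetReps J, x ≤ w →
      ∃ (r₁ : GradeMinOrder ℕ (cs.intervalCoset J w x))
        (r₂ : GradeMinOrder ℕ (Set.Iic (cs.mJ J w x)))
        (f : cs.intervalCoset J w x ≃o Set.Iic (cs.mJ J w x)),
        (∀ y : cs.intervalCoset J w x, (f y : W) = x⁻¹ * (y : W)) ∧
        (∀ y : cs.intervalCoset J w x, cs.length (y : W) = cs.length x + r₁.grade y) ∧
        (∀ z : Set.Iic (cs.mJ J w x), r₂.grade z = cs.length (z : W)) ∧
        (∀ y : cs.intervalCoset J w x, r₂.grade (f y) = r₁.grade y)) ∧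
    cs.mJ J w v = u ∧
    (∀ x ∈ cs.minCosetReps J, ∀ x' ∈ cs.minCosetReps J, x < x' → x' ≤ v →
      cs.mJ J w x' ≤ cs.mJ J w x) ∧
    (∀ x ∈ cs.minCosetReps J, x ≤ v →
      cs.mJ J w x ∈ Set.Icc (cs.mJ J w v) (cs.mJ J w 1)) := by
  let _ : PartialOrder W := cs.bruhatOrder
  obtain ⟨rfl, -, hv, hu⟩ := hw
  have hvw := CoxeterSystem.bruhatLE_mul_right hv hu
  refine ⟨fun x hx hxw ↦ ?_, fun x hx hxw ↦ ?_, CoxeterSystem.mJ_mul_self hv hu,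
    fun x hx x' hx' h h' ↦ CoxeterSystem.mJ_antitone hx hx' h.le (h'.trans hvw),
    fun x hx h ↦ ⟨CoxeterSystem.mJ_antitone hx hv h hvw,
      CoxeterSystem.mJ_antitone (CoxeterSystem.one_mem_minCosetReps J) hx
        (CoxeterSystem.one_bruhatLE x) (h.trans hvw)⟩⟩
  · obtain ⟨hm, hiff⟩ := CoxeterSystem.mJ_spec hx hxw
    have h := CoxeterSystem.maximal_intervalCoset_iff hx hm hiff
    exact ⟨_, (h _).2 rfl, fun q hq ↦ (h q).1 hq⟩
  · have hlow : ∀ (a : Set.Iic (cs.mJ J (v * u) x)) (z : W), cs.BruhatLE z a →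
        ∃ b : Set.Iic (cs.mJ J (v * u) x), (b : W) = z := fun a z hz ↦ ⟨⟨z, hz.trans a.2⟩, rfl⟩
    let f := CoxeterSystem.intervalCosetIso hx hxw
    refine ⟨CoxeterSystem.lengthGradeMinOrder (cs := cs) (fun y ↦ (f y : W))
        (fun a b ↦ f.le_iff_le) (fun a z hz ↦ ?_),
      CoxeterSystem.lengthGradeMinOrder (cs := cs) Subtype.val (fun a b ↦ Iff.rfl) hlow,
      f, fun y ↦ rfl, ?_, fun z ↦ rfl, fun y ↦ rfl⟩
    · obtain ⟨b, rfl⟩ := hlow (f a) z hz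
      exact ⟨f.symm b, by simp⟩
    · rintro ⟨_, hy, a, ha, rfl⟩
      change cs.length (x * a) = cs.length x + cs.length (x⁻¹ * (x * a))
      rw [inv_mul_cancel_left, CoxeterSystem.length_mul_of_mem_minCosetReps hx ha]
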